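/- Let $L, T, M$ be non-negative integers with $M \le T$, and let $$\mathcal S_{T,M} = \{\Phi \in \mathbb{C}^{T\times M} : \Phi^*\Phi = I_M\}$$ be the complex Stiefel manifold. The space $\mathcal{M} = (\mathcal S_{T,M})^L$ of all constellations $(\Phi_1,\dots,\Phi_L)$ of size $L$, block length $T$ and with $M$ antennas, with its usual topology (as a subspace of $(\mathbb{C}^{T\times M})^L$), is a compact smooth real manifold (Hausdorff, second countable, without boundary) of dimension $2LTM - LM^2$. More precisely, it carries a smooth structure of this dimension for which the inclusion into $(\mathbb{C}^{T\times M})^L = \mathbb{R}^{2LTM}$ is a smooth embedding. -/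

import Mathlib

open scoped Manifold ContDiff Matrix

/-- The complex Stiefel manifold `S_{T,M}`: the set of `T × M` complex matrices `Φ` with
`Φ* Φ = I_M`. As a type it carries the subspace topology of the space of matrices. -/
def stiefel (T M : ℕ) : Set (Matrix (Fin T) (Fin M) ℂ) :=
  {Φ | Φᴴ * Φ = 1}

/-- The space `(S_{T,M})^L` of all constellations of size `L`, block length `T`, with `M` antennas,
with the product topology. -/
abbrev Constellations (L T M : ℕ) : Type :=
  Fin L → stiefel T M

/-- The inclusion of `(S_{T,M})^L` into the real normed space `(ℂ^{T × M})^L = ℝ^{2LTM}` which sends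
a constellation to the family of the entries of its matrices. -/
def constellationEntries (L T M : ℕ) :
    Constellations L T M → (Fin L → Fin T → Fin M → ℂ) :=
  fun V l i j => (V l : Matrix (Fin T) (Fin M) ℂ) i j

/-!
The constellation space is the level set `V ↦ (V_l* V_l)_l = (1, …, 1)` of a map from
`(ℂ^{T × M})^L` to the `L`-tuples of Hermitian `M × M` matrices, and `1` is a regular value.
Indeed, if `Φ* Φ = 1` and `S` is Hermitian, then `t ↦ Φ (1 + tS / 2)` has Gram matrix
`(1 + tS / 2)² = 1 + tS + O(t²)`, so the derivative at `Φ` takes the value `S`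
(`surjective_fderiv_gramCoordinates`). The Hermitian matrices have real dimension `M²`, half that of
all matrices (`finrank_real_eq_two_mul_finrank_selfAdjoint`), so the level set has dimension
`2LTM - LM²`.

The general step is the regular value theorem for embedded submanifolds
(`Topology.IsEmbedding.exists_chartedSpace_of_regular_level`). By the inverse function theorem a
smooth map with surjective derivative is locally the second coordinate of a chart with values in
`V × F` (`ContDiff.exists_chart_snd_eq`); such a chart identifies the level set with the slice
`V × {0}`. The first coordinates form a smooth atlas, and in these charts the inclusion is
`v ↦ (v, 0)`, hence an immersion (`Topology.IsEmbedding.exists_chartedSpace_of_sliceCharts`).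

Compactness holds because the columns of a matrix with `Φ* Φ = 1` are unit vectors, so the Stiefel
manifold is closed in a product of closed discs.
-/

open Set Topology Module

/-! ### Charts induced by slices -/

section SliceChart

variable {X E V W : Type*} [TopologicalSpace X] [TopologicalSpace E] [TopologicalSpace V]
  [TopologicalSpace W] [Zero W] {ι : X → E}

/-- A chart `ψ` of `E` with values in `V × W` in which the image of a topological embedding
`ι : X → E` is the slice `V × {0}` induces a chart of `X` with values in `V`, namely the first
coordinate of `ψ ∘ ι`. -/
noncomputable def Topology.IsEmbedding.sliceChart [Nonempty X] (hι : IsEmbedding ι)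
    (ψ : OpenPartialHomeomorph E (V × W))
    (hψ : ∀ y ∈ ψ.source, y ∈ range ι ↔ (ψ y).2 = 0) : OpenPartialHomeomorph X V where
  toFun x := (ψ (ι x)).1
  invFun v := Function.invFun ι (ψ.symm (v, 0))
  source := ι ⁻¹' ψ.source
  target := (fun v : V ↦ (v, (0 : W))) ⁻¹' ψ.target
  map_source' x hx := by
    have h : (ψ (ι x)).2 = 0 := (hψ _ hx).1 (mem_range_self x)
    have := ψ.map_source hx
    rwa [← Prod.mk.eta (p := ψ (ι x)), h] at this
  map_target' v hv := by
    have h1 : ψ.symm (v, 0) ∈ ψ.source := ψ.map_target hv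
    have h2 : ψ.symm (v, 0) ∈ range ι := (hψ _ h1).2 (by rw [ψ.right_inv hv])
    rw [mem_preimage, Function.invFun_eq h2]
    exact h1
  left_inv' x hx := by
    have h : (ψ (ι x)).2 = 0 := (hψ _ hx).1 (mem_range_self x)
    have h' : ((ψ (ι x)).1, (0 : W)) = ψ (ι x) := Prod.ext rfl h.symm
    rw [h', ψ.left_inv hx, Function.leftInverse_invFun hι.injective]
  right_inv' v hv := by
    have h1 : ψ.symm (v, 0) ∈ ψ.source := ψ.map_target hv
    have h2 : ψ.symm (v, 0) ∈ range ι := (hψ _ h1).2 (by rw [ψ.right_inv hv])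
    rw [Function.invFun_eq h2, ψ.right_inv hv]
  open_source := ψ.open_source.preimage hι.continuous
  open_target := ψ.open_target.preimage (by fun_prop)
  continuousOn_toFun := continuous_fst.comp_continuousOn
    (ψ.continuousOn.comp hι.continuous.continuousOn fun _ hx ↦ hx)
  continuousOn_invFun := by
    rw [hι.continuousOn_iff]
    refine ContinuousOn.congr (f := fun v : V ↦ ψ.symm (v, 0))
      (ψ.continuousOn_symm.comp (by fun_prop) fun v hv ↦ hv) fun v hv ↦ ?_
    exact Function.invFun_eq ((hψ _ (ψ.map_target hv)).2 (by rw [ψ.right_inv hv]))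

variable [Nonempty X] (hι : IsEmbedding ι) {ψ : OpenPartialHomeomorph E (V × W)}
  (hψ : ∀ y ∈ ψ.source, y ∈ range ι ↔ (ψ y).2 = 0)

theorem Topology.IsEmbedding.apply_sliceChart_symm {v : V} (hv : (v, (0 : W)) ∈ ψ.target) :
    ι ((hι.sliceChart ψ hψ).symm v) = ψ.symm (v, 0) :=
  Function.invFun_eq ((hψ _ (ψ.map_target hv)).2 (by rw [ψ.right_inv hv]))

end SliceChart

/-! ### Embeddings that are locally slices -/

section Submanifold

variable {X E V W : Type*} [TopologicalSpace X]
  [NormedAddCommGroup E] [NormedSpace ℝ E] [NormedAddCommGroup V] [NormedSpace ℝ V]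
  [NormedAddCommGroup W] [NormedSpace ℝ W] {ι : X → E}

/-- A topological embedding whose image is locally a slice `V × {0}` in smooth coordinates of the
ambient space makes its source a smooth submanifold. -/
theorem Topology.IsEmbedding.exists_chartedSpace_of_sliceCharts (hι : IsEmbedding ι)
    (A : (V × W) ≃L[ℝ] E)
    (h : ∀ x : X, ∃ ψ : OpenPartialHomeomorph E (V × W), ι x ∈ ψ.source ∧
      ContDiffOn ℝ ∞ ψ ψ.source ∧ ContDiffOn ℝ ∞ ψ.symm ψ.target ∧
      ∀ y ∈ ψ.source, y ∈ range ι ↔ (ψ y).2 = 0) :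
    ∃ _ : ChartedSpace V X, IsManifold 𝓘(ℝ, V) ∞ X ∧
      Manifold.IsSmoothEmbedding 𝓘(ℝ, V) 𝓘(ℝ, E) ∞ ι := by
  choose ψ hmem hsm hsymm hslice using h
  let c (x : X) : OpenPartialHomeomorph X V :=
    haveI : Nonempty X := ⟨x⟩
    hι.sliceChart (ψ x) (hslice x)
  let cs : ChartedSpace V X :=
    { atlas := range c
      chartAt := c
      mem_chart_source := hmem
      chart_mem_atlas := mem_range_self }
  have hc (x : X) {v : V} (hv : v ∈ (c x).target) : ι ((c x).symm v) = (ψ x).symm (v, 0) :=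
    haveI : Nonempty X := ⟨x⟩
    hι.apply_sliceChart_symm (hslice x) hv
  have hman : IsManifold 𝓘(ℝ, V) ∞ X := by
    refine isManifold_of_contDiffOn _ _ _ ?_
    rintro _ _ ⟨x, rfl⟩ ⟨y, rfl⟩
    have key : ContDiffOn ℝ ∞ (fun v : V ↦ (ψ y ((ψ x).symm (v, 0))).1)
        ((c x).symm.trans (c y)).source := by
      refine contDiff_fst.comp_contDiffOn ((hsm y).comp ((hsymm x).comp
        (f := fun v : V ↦ (v, (0 : W))) (by fun_prop) fun v hv ↦ hv.1) fun v hv ↦ ?_)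
      have h2 : ι ((c x).symm v) ∈ (ψ y).source := hv.2
      rwa [hc x hv.1] at h2
    have : ContDiffOn ℝ ∞ ((c x).symm.trans (c y)) ((c x).symm.trans (c y)).source := by
      refine key.congr fun v hv ↦ ?_
      change (ψ y (ι ((c x).symm v))).1 = _
      rw [hc x hv.1]
    simpa using this
  refine ⟨cs, hman, ?_, hι⟩
  refine Manifold.IsImmersionOfComplement.isImmersion (F := W) fun x ↦ ?_
  refine Manifold.IsImmersionAtOfComplement.mk_of_charts A (c x)
    ((ψ x).trans A.toHomeomorph.toOpenPartialHomeomorph) (hmem x) ?_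
    (IsManifold.subset_maximalAtlas ⟨x, rfl⟩) ?_ ?_ ?_
  · simpa using hmem x
  · apply OpenPartialHomeomorph.mem_maximalAtlas_of_contMDiffOn
    · rw [contMDiffOn_iff_contDiffOn]
      exact A.contDiff.comp_contDiffOn ((hsm x).mono (by simp))
    · rw [contMDiffOn_iff_contDiffOn]
      exact (hsymm x).comp A.symm.contDiff.contDiffOn fun v hv ↦ hv.2
  · intro y hy
    have hy' : ι y ∈ (ψ x).source := hy
    simpa using hy'
  · intro v hv
    have hv' : v ∈ (c x).target := by simpa using hv
    have : ψ x (ι ((c x).symm v)) = (v, 0) := by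
      rw [hc x hv']
      exact (ψ x).right_inv hv'
    simpa using this

end Submanifold

/-! ### The regular value theorem -/

section RegularValue

variable {E F V : Type*} [NormedAddCommGroup E] [NormedSpace ℝ E] [FiniteDimensional ℝ E]
  [NormedAddCommGroup F] [NormedSpace ℝ F] [FiniteDimensional ℝ F]
  [NormedAddCommGroup V] [NormedSpace ℝ V] [FiniteDimensional ℝ V]

/-- A surjective linear map is the second coordinate of a linear isomorphism. -/
theorem LinearMap.exists_equiv_prod_of_surjective (A : E →ₗ[ℝ] F)
    (hA : Function.Surjective A) (hd : finrank ℝ E = finrank ℝ V + finrank ℝ F) :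
    ∃ P : E ≃L[ℝ] V × F, ∀ x, (P x).2 = A x := by
  obtain ⟨q, hq⟩ := Submodule.exists_isCompl (LinearMap.ker A)
  have hker : finrank ℝ (LinearMap.ker A) = finrank ℝ V := by
    have h1 := A.finrank_range_add_finrank_ker
    rw [LinearMap.range_eq_top.2 hA, finrank_top] at h1
    omega
  let p : E →ₗ[ℝ] V :=
    (LinearEquiv.ofFinrankEq (LinearMap.ker A) V hker).toLinearMap ∘ₗ
      (LinearMap.ker A).projectionOnto q hq
  have hinj : Function.Injective (p.prod A) := by
    rw [← LinearMap.ker_eq_bot, LinearMap.ker_eq_bot']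
    intro x hx
    have hA0 : A x = 0 := congrArg Prod.snd hx
    have hp0 : (LinearMap.ker A).projectionOnto q hq x = 0 := by
      simpa [p] using congrArg Prod.fst hx
    have := Submodule.projectionOnto_apply_left hq ⟨x, hA0⟩
    rw [hp0] at this
    exact (congrArg Subtype.val this).symm
  refine ⟨(LinearEquiv.ofInjectiveOfFinrankEq (p.prod A) hinj
    (by rw [finrank_prod, hd])).toContinuousLinearEquiv, fun x ↦ rfl⟩

/-- Near a point where its derivative is surjective, a smooth map is, up to a constant, the
second coordinate of a smooth chart. -/
theorem ContDiff.exists_chart_snd_eq {f : E → F} (hf : ContDiff ℝ ∞ f) (a : E)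
    (hs : Function.Surjective (fderiv ℝ f a))
    (hd : finrank ℝ E = finrank ℝ V + finrank ℝ F) (c : F) :
    ∃ ψ : OpenPartialHomeomorph E (V × F), a ∈ ψ.source ∧
      ContDiffOn ℝ ∞ ψ ψ.source ∧ ContDiffOn ℝ ∞ ψ.symm ψ.target ∧
      ∀ y ∈ ψ.source, (ψ y).2 = f y - c := by
  obtain ⟨P, hP⟩ := LinearMap.exists_equiv_prod_of_surjective (V := V)
    (fderiv ℝ f a).toLinearMap hs hd
  let g : E → V × F := fun y ↦ ((P y).1, f y - c)
  have hg : ContDiff ℝ ∞ g := by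
    have := P.contDiff (n := ∞)
    fun_prop
  have hn : (∞ : ℕ∞ω) ≠ 0 := by simp
  have hg' : HasFDerivAt g (P : E →L[ℝ] V × F) a := by
    have h1 : HasFDerivAt (fun y ↦ (P y).1) ((ContinuousLinearMap.fst ℝ V F).comp
      (P : E →L[ℝ] V × F)) a :=
      ((ContinuousLinearMap.fst ℝ V F).comp (P : E →L[ℝ] V × F)).hasFDerivAt
    have h2 := ((hf.differentiable hn a).hasFDerivAt).sub_const c
    refine (h1.prodMk h2).congr_fderiv ?_
    ext x
    · rfl
    · exact (hP x).symm
  let ψ₀ := hg.contDiffAt.toOpenPartialHomeomorph g hg' hn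
  -- The inverse is known to be smooth only where the derivative is invertible.
  let U : Set E := fderiv ℝ g ⁻¹' range ((↑) : (E ≃L[ℝ] V × F) → E →L[ℝ] V × F)
  have hU : IsOpen U := (ContinuousLinearEquiv.isOpen).preimage (hg.continuous_fderiv hn)
  have haU : a ∈ U := ⟨P, hg'.fderiv.symm⟩
  refine ⟨ψ₀.restrOpen U hU, ⟨hg.contDiffAt.mem_toOpenPartialHomeomorph_source hg' hn, haU⟩,
    hg.contDiffOn, fun y hy ↦ ?_, fun y _ ↦ rfl⟩
  obtain ⟨P', hP'⟩ := ((ψ₀.restrOpen U hU).map_target hy).2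
  refine (OpenPartialHomeomorph.contDiffAt_symm _ hy (f₀' := P') ?_ hg.contDiffAt).contDiffWithinAt
  rw [hP']
  exact (hg.differentiable hn _).hasFDerivAt

/-- The regular value theorem: a regular level set, presented as the image of a topological
embedding `ι`, is a smooth submanifold. -/
theorem Topology.IsEmbedding.exists_chartedSpace_of_regular_level {X : Type*} [TopologicalSpace X]
    {ι : X → E} (hι : IsEmbedding ι) {f : E → F} (hf : ContDiff ℝ ∞ f) {c : F}
    (hrange : range ι = f ⁻¹' {c}) (hs : ∀ x, Function.Surjective (fderiv ℝ f (ι x)))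
    (hd : finrank ℝ E = finrank ℝ V + finrank ℝ F) :
    ∃ _ : ChartedSpace V X, IsManifold 𝓘(ℝ, V) ∞ X ∧
      Manifold.IsSmoothEmbedding 𝓘(ℝ, V) 𝓘(ℝ, E) ∞ ι := by
  refine hι.exists_chartedSpace_of_sliceCharts (W := F)
    (ContinuousLinearEquiv.ofFinrankEq (by rw [finrank_prod, hd])) fun x ↦ ?_
  obtain ⟨ψ, h1, h2, h3, h4⟩ := hf.exists_chart_snd_eq (ι x) (hs x) hd c
  refine ⟨ψ, h1, h2, h3, fun y hy ↦ ?_⟩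
  rw [h4 y hy, hrange, sub_eq_zero]
  rfl

end RegularValue

/-- The directional derivative of a map which is quadratic along a line. -/
theorem DifferentiableAt.fderiv_apply_of_quadratic {E F : Type*}
    [NormedAddCommGroup E] [NormedSpace ℝ E] [NormedAddCommGroup F] [NormedSpace ℝ F]
    {f : E → F} {a h : E} {s r : F}
    (hf : DifferentiableAt ℝ f a) (hq : ∀ t : ℝ, f (a + t • h) = f a + t • s + t ^ 2 • r) :
    fderiv ℝ f a h = s := by
  have h1 := hf.hasFDerivAt.hasLineDerivAt h
  have h2 : HasLineDerivAt ℝ f s a h := by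
    have h3 : HasDerivAt (fun t : ℝ ↦ f a + t • s + t ^ 2 • r) s 0 := by
      simpa [Pi.add_def] using (((hasDerivAt_id (0 : ℝ)).smul_const s).const_add (f a)).add
        (((hasDerivAt_id (0 : ℝ)).pow 2).smul_const r)
    exact h3.congr_of_eventuallyEq (.of_forall hq)
  exact h1.unique h2

/-! ### Real coordinates on Hermitian matrices -/

section Hermitian

open scoped ComplexStarModule

/-- A complex vector space with a conjugation has twice the real dimension of its real form: an
element is determined by its real and imaginary parts. -/
theorem finrank_real_eq_two_mul_finrank_selfAdjoint (A : Type*) [AddCommGroup A] [Module ℂ A]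
    [StarAddMonoid A] [StarModule ℂ A] [FiniteDimensional ℝ A] :
    finrank ℝ A = 2 * finrank ℝ (selfAdjoint A) := by
  have e : A ≃ₗ[ℝ] selfAdjoint A × selfAdjoint A := by
    refine LinearEquiv.ofBijective (realPart.prod imaginaryPart) ⟨?_, fun ⟨a, b⟩ ↦ ?_⟩
    · intro x y hxy
      rw [← realPart_add_I_smul_imaginaryPart x, ← realPart_add_I_smul_imaginaryPart y]
      have h1 : ℜ x = ℜ y := congrArg Prod.fst hxy
      have h2 : ℑ x = ℑ y := congrArg Prod.snd hxy
      rw [h1, h2]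
    · exact ⟨(a : A) + Complex.I • (b : A), by ext <;> simp⟩
  have : FiniteDimensional ℝ (selfAdjoint A) :=
    FiniteDimensional.of_injective (selfAdjoint.submodule ℝ A).subtype Subtype.val_injective
  rw [e.finrank_eq, finrank_prod, two_mul]

/-- Real coordinates on the `M × M` Hermitian matrices, extended to all matrices. -/
theorem exists_hermitian_coordinates (M : ℕ) :
    ∃ ρ : Matrix (Fin M) (Fin M) ℂ →ₗ[ℝ] (Fin (M ^ 2) → ℝ),
      InjOn ρ {S | S.IsHermitian} ∧ SurjOn ρ {S | S.IsHermitian} univ := by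
  let A := Matrix (Fin M) (Fin M) ℂ
  have : FiniteDimensional ℝ (selfAdjoint A) :=
    FiniteDimensional.of_injective (selfAdjoint.submodule ℝ A).subtype Subtype.val_injective
  have hA : finrank ℝ A = M * M * 2 := by
    rw [finrank_matrix]; simp
  have hd : finrank ℝ (selfAdjoint A) = finrank ℝ (Fin (M ^ 2) → ℝ) := by
    have := finrank_real_eq_two_mul_finrank_selfAdjoint A
    rw [finrank_fin_fun]
    nlinarith
  let e := LinearEquiv.ofFinrankEq _ _ hd
  refine ⟨e.toLinearMap ∘ₗ realPart, fun S hS S' hS' h ↦ ?_, fun s _ ↦ ?_⟩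
  · rw [← IsSelfAdjoint.coe_realPart (x := S) hS, ← IsSelfAdjoint.coe_realPart (x := S') hS']
    exact congrArg Subtype.val (e.injective h)
  · refine ⟨(e.symm s : A), (e.symm s).2, ?_⟩
    simp

end Hermitian

/-! ### The Stiefel manifold and the Gram map -/

section Stiefel

theorem norm_entry_le_one_of_mem_stiefel {T M : ℕ} {Φ : Matrix (Fin T) (Fin M) ℂ}
    (hΦ : Φ ∈ stiefel T M) (i : Fin T) (j : Fin M) : ‖Φ i j‖ ≤ 1 := by
  have h : ∑ k, ‖Φ k j‖ ^ 2 = 1 := by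
    have h1 : (Φᴴ * Φ) j j = 1 := by rw [show Φᴴ * Φ = 1 from hΦ, Matrix.one_apply_eq]
    have h2 : ((∑ k, ‖Φ k j‖ ^ 2 : ℝ) : ℂ) = 1 := by
      rw [← h1, Matrix.mul_apply]
      push_cast
      exact Finset.sum_congr rfl fun k _ ↦ (Complex.conj_mul' _).symm
    exact_mod_cast h2
  have h3 : ‖Φ i j‖ ^ 2 ≤ 1 :=
    h ▸ Finset.single_le_sum (f := fun k ↦ ‖Φ k j‖ ^ 2) (fun k _ ↦ by positivity)
      (Finset.mem_univ i)
  exact (sq_le_one_iff₀ (norm_nonneg _)).1 h3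

theorem isCompact_stiefel (T M : ℕ) : IsCompact (stiefel T M) := by
  have hK : IsCompact (univ.pi fun _ : Fin T ↦ univ.pi fun _ : Fin M ↦
      Metric.closedBall (0 : ℂ) 1) :=
    isCompact_univ_pi fun _ ↦ isCompact_univ_pi fun _ ↦ isCompact_closedBall _ _
  refine hK.of_isClosed_subset ?_ fun Φ hΦ i _ j _ ↦ ?_
  · exact isClosed_eq (f := fun Φ : Matrix (Fin T) (Fin M) ℂ ↦ Φᴴ * Φ)
      (continuous_id.matrix_conjTranspose.matrix_mul continuous_id) continuous_const
  · rw [mem_closedBall_zero_iff]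
    exact norm_entry_le_one_of_mem_stiefel hΦ i j

theorem isEmbedding_constellationEntries (L T M : ℕ) :
    IsEmbedding (constellationEntries L T M) :=
  IsEmbedding.piMap (f := fun _ : Fin L ↦
    (Subtype.val : stiefel T M → Matrix (Fin T) (Fin M) ℂ)) fun _ ↦ .subtypeVal

theorem range_constellationEntries (L T M : ℕ) :
    range (constellationEntries L T M) =
      {V | ∀ l, (Matrix.of (V l))ᴴ * Matrix.of (V l) = 1} := by
  ext V
  refine ⟨?_, fun h ↦ ⟨fun l ↦ ⟨Matrix.of (V l), h l⟩, rfl⟩⟩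
  rintro ⟨Φ, rfl⟩ l
  exact (Φ l).2

/-- The Gram matrices `Φ* Φ` of a family of matrices, in the real coordinates `ρ`. -/
noncomputable def gramCoordinates {L T M : ℕ}
    (ρ : Matrix (Fin M) (Fin M) ℂ →ₗ[ℝ] (Fin (M ^ 2) → ℝ)) (V : Fin L → Fin T → Fin M → ℂ) :
    Fin L → Fin (M ^ 2) → ℝ :=
  fun l ↦ ρ ((Matrix.of (V l))ᴴ * Matrix.of (V l))

variable {L T M : ℕ} (ρ : Matrix (Fin M) (Fin M) ℂ →ₗ[ℝ] (Fin (M ^ 2) → ℝ))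

theorem contDiff_gramCoordinates :
    ContDiff ℝ ∞ (gramCoordinates ρ : (Fin L → Fin T → Fin M → ℂ) → _) := by
  -- Matrices carry no global norm, so `ρ` is read on the underlying functions.
  let ρ' : (Fin M → Fin M → ℂ) →ₗ[ℝ] (Fin (M ^ 2) → ℝ) := ρ
  have hρ : ContDiff ℝ ∞ ρ' := ρ'.toContinuousLinearMap.contDiff
  refine contDiff_pi.2 fun l ↦ hρ.comp
    (f := fun V : Fin L → Fin T → Fin M → ℂ ↦ fun i j ↦ ∑ k, star (V l k i) * V l k j) ?_
  refine contDiff_pi.2 fun i ↦ contDiff_pi.2 fun j ↦ ContDiff.sum fun k _ ↦ ?_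
  have hc : ContDiff ℝ ∞ (star : ℂ → ℂ) := Complex.conjCLE.contDiff
  fun_prop

/-- Moving a matrix `Φ` with `Φ* Φ = 1` in the direction `ΦS / 2`, with `S` Hermitian, changes its
Gram matrix by `S` to first order, because the moved matrix is `Φ (1 + tS / 2)`. -/
theorem conjTranspose_mul_self_add_smul {Φ : Matrix (Fin T) (Fin M) ℂ} (hΦ : Φᴴ * Φ = 1)
    {S : Matrix (Fin M) (Fin M) ℂ} (hS : S.IsHermitian) (t : ℝ) :
    (Φ + t • ((1 / 2 : ℝ) • (Φ * S)))ᴴ * (Φ + t • ((1 / 2 : ℝ) • (Φ * S))) =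
      Φᴴ * Φ + t • S + t ^ 2 • ((1 / 4 : ℝ) • (S * S)) := by
  have hfac : Φ + t • ((1 / 2 : ℝ) • (Φ * S)) = Φ * (1 + (t / 2) • S) := by
    rw [Matrix.mul_add, Matrix.mul_one, Matrix.mul_smul, smul_smul, mul_one_div]
  have hherm : (1 + (t / 2) • S)ᴴ = 1 + (t / 2) • S := by
    rw [Matrix.conjTranspose_add, Matrix.conjTranspose_one, Matrix.conjTranspose_smul,
      hS.eq, star_trivial]
  rw [hfac, Matrix.conjTranspose_mul, hherm, Matrix.mul_assoc, ← Matrix.mul_assoc Φᴴ, hΦ,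
    Matrix.one_mul]
  simp only [mul_add, add_mul, one_mul, mul_one, Matrix.smul_mul, Matrix.mul_smul]
  module

/-- At a family of matrices with `Φ* Φ = 1`, the derivative of `Φ ↦ Φ* Φ` maps `ΦS / 2` to the
Hermitian matrix `S`, so it is onto the Hermitian matrices. -/
theorem surjective_fderiv_gramCoordinates (hρ : SurjOn ρ {S | S.IsHermitian} univ)
    {V : Fin L → Fin T → Fin M → ℂ} (hV : ∀ l, (Matrix.of (V l))ᴴ * Matrix.of (V l) = 1) :
    Function.Surjective (fderiv ℝ (gramCoordinates ρ) V) := by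
  intro s
  choose S hS hSs using fun l ↦ hρ (mem_univ (s l))
  let H : Fin L → Fin T → Fin M → ℂ := fun l ↦ (1 / 2 : ℝ) • (Matrix.of (V l) * S l)
  refine ⟨H, ?_⟩
  refine DifferentiableAt.fderiv_apply_of_quadratic (r := fun l ↦ ρ ((1 / 4 : ℝ) • (S l * S l)))
    ((contDiff_gramCoordinates ρ).differentiable (by simp) V) fun t ↦ ?_
  funext l
  refine (congrArg ρ (conjTranspose_mul_self_add_smul (hV l) (hS l) t)).trans ?_
  rw [map_add, map_add, map_smul, map_smul _ (t ^ 2), hSs l]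
  rfl

theorem range_constellationEntries_eq_preimage (hρ : InjOn ρ {S | S.IsHermitian}) :
    range (constellationEntries L T M) = gramCoordinates ρ ⁻¹' {fun _ ↦ ρ 1} := by
  rw [range_constellationEntries]
  ext V
  refine ⟨fun h ↦ funext fun l ↦ congrArg ρ (h l), fun h l ↦ ?_⟩
  exact hρ (Matrix.isHermitian_conjTranspose_mul_self _) Matrix.isHermitian_one (congrFun h l)

end Stiefel

theorem mainTheorem6 (L T M : ℕ) (hMT : M ≤ T) :
    CompactSpace (Constellations L T M) ∧
    T2Space (Constellations L T M) ∧
    SecondCountableTopology (Constellations L T M) ∧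
    ∃ d : ℕ, (d : ℤ) = 2 * L * T * M - L * M ^ 2 ∧
      ∃ _ : ChartedSpace (EuclideanSpace ℝ (Fin d)) (Constellations L T M),
        IsManifold (𝓡 d) ∞ (Constellations L T M) ∧
        Manifold.IsSmoothEmbedding (𝓡 d) 𝓘(ℝ, Fin L → Fin T → Fin M → ℂ) ∞
          (constellationEntries L T M) := by
  have hemb := isEmbedding_constellationEntries L T M
  have : CompactSpace (stiefel T M) := isCompact_iff_compactSpace.1 (isCompact_stiefel T M)
  obtain ⟨ρ, hinj, hsurj⟩ := exists_hermitian_coordinates M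
  have hle : L * M ^ 2 ≤ 2 * L * T * M := by
    have : L * M * M ≤ L * M * T := Nat.mul_le_mul_left _ hMT
    nlinarith
  refine ⟨inferInstance, hemb.t2Space, hemb.secondCountableTopology,
    2 * L * T * M - L * M ^ 2, by push_cast [Nat.cast_sub hle]; ring, ?_⟩
  refine hemb.exists_chartedSpace_of_regular_level (contDiff_gramCoordinates ρ)
    (range_constellationEntries_eq_preimage ρ hinj) (fun Φ ↦ ?_) ?_
  · exact surjective_fderiv_gramCoordinates ρ hsurj fun l ↦ (Φ l).2
  · have h1 : finrank ℝ (Fin L → Fin T → Fin M → ℂ) = 2 * L * T * M := by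
      simp only [finrank_pi_fintype, Complex.finrank_real_complex, Finset.sum_const,
        Finset.card_univ, Fintype.card_fin, smul_eq_mul]
      ring
    have h2 : finrank ℝ (Fin L → Fin (M ^ 2) → ℝ) = L * M ^ 2 := by
      simp [finrank_pi_fintype]
    rw [h1, h2, finrank_euclideanSpace_fin, Nat.sub_add_cancel hle]
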